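/- Theorem (Transcription methods hierarchy). Let $d\ge 1$, let $\bar{\bm y}\in\mathbb{R}^d$, let $\bm\Sigma\in\mathbb{R}^{d\times d}$ be symmetric positive definite, and let $\bm y\sim\mathcal N(\bar{\bm y},\bm\Sigma)$ be a Gaussian random vector. For vectors, $\bm v\preceq\bm w$ means $v_i\le w_i$ for all $i\in\{1,\dots,d\}$. Notation. Let $\beta_R=1-\mathbb P(\bm y\preceq \bm 0)$ be the real failure risk. Let $\Phi_d$ be the cumulative distribution function of the chi-squared distribution with $d$ degrees of freedom, and put $\Psi_d(r)=1-\Phi_d(r^2)$ for $r\ge 0$, $\Psi_d(r)=1$ for $r<0$, and $\Delta\Psi_d(R_1,R_2)=\Psi_d(R_1)-\Psi_d(R_2)$. Let $\sigma_i=\sqrt{\Sigma_{ii}}$, let $\rho(\bm\Sigma)$ be the positive square root of the spectral radius of $\bm\Sigma$, and let $r_i=-\bar y_i/\sigma_i$. Let $\tilde r_1\le\dots\le\tilde r_d$ be the entries of $(r_1,\dots,r_d)$ in increasing order, and $\tilde r_0=0$. Let $I_x(a,b)=\frac{1}{B(a,b)}\int_0^x t^{a-1}(1-t)^{b-1}\,dt$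 be the regularized incomplete beta function and $\mathcal I(x)=I_{1-x^2}\left(\frac{d-1}{2},\frac12\right)$. The spectral radius, first-order and $d$-th order failure risk estimations are $$\beta_{T,\rho}=\Psi_d\left(\frac{\min_i(-\bar y_i)}{\rho(\bm\Sigma)}\right),\qquad \beta_{T,1}=\Psi_d\left(\min_i r_i\right),$$ $$\beta_{T,d}=1-\sum_{i=1}^d\Delta\Psi_d(\tilde r_{i-1},\tilde r_i)\,\max\left[0,\;1-\frac12\sum_{j=1}^{i-1}\mathcal I\left(\frac{\tilde r_j}{\tilde r_i}\right)\right]$$ (a term with $\tilde r_i=0$ is $0$, because then $\tilde r_{i-1}=\tilde r_i$). The conservatism of an estimation $\beta_T\in[0,1]$ is $$\gamma(\beta_T)=\frac{\beta_T}{\beta_R}\sqrt{\frac{1-\beta_R^2}{1-\beta_T^2}}\in[0,\infty],\qquad \gamma(1)=\infty,$$ and $\gamma_d=\gamma(\beta_{T,d})$, $\gamma_1=\gamma(\beta_{T,1})$, $\gamma_\rho=\gamma(\beta_{T,\rho})$. Claim. If $\bar{\bm y}\preceq\bm 0$, then $0<\beta_R<1$, $$\beta_R\le\beta_{T,d}\le\beta_{T,1}\le\beta_{T,\rho}\le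 1,$$ the function $\gamma$ is strictly increasing on $[0,1]$, and $$1\le\gamma_d\le\gamma_1\le\gamma_\rho .$$ -/

import Mathlib

open MeasureTheory ProbabilityTheory
open scoped ENNReal

namespace ChanceConstraint

/-- The chi-squared distribution with `d` degrees of freedom: the law of the sum of the squares of
`d` independent standard normal variables. -/
noncomputable def chiSquared (d : ℕ) : Measure ℝ :=
  (Measure.pi fun _ : Fin d => gaussianReal 0 1).map fun z => ∑ i, z i ^ 2

/-- `Ψ_d(r) = 1 - Φ_d(r²)` for `r ≥ 0` and `Ψ_d(r) = 1` for `r < 0`, where `Φ_d` is the cumulative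
distribution function of the chi-squared distribution with `d` degrees of freedom. -/
noncomputable def Psi (d : ℕ) (r : ℝ) : ℝ :=
  if 0 ≤ r then 1 - cdf (chiSquared d) (r ^ 2) else 1

/-- `ΔΨ_d(R₁, R₂) = Ψ_d(R₁) - Ψ_d(R₂)`. -/
noncomputable def deltaPsi (d : ℕ) (R₁ R₂ : ℝ) : ℝ := Psi d R₁ - Psi d R₂

/-- The regularized incomplete beta function
`I_x(a, b) = (1 / B(a, b)) ∫₀ˣ t^(a-1) (1-t)^(b-1) dt`. -/
noncomputable def regIncBeta (x a b : ℝ) : ℝ :=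
  1 / ProbabilityTheory.beta a b * ∫ t in (0 : ℝ)..x, t ^ (a - 1) * (1 - t) ^ (b - 1)

/-- `𝓘(x) = I_{1-x²}((d-1)/2, 1/2)`. For `θ ∈ [0, π/2]`, `𝓘(cos θ) / 2 = I_{sin² θ}((d-1)/2, 1/2) / 2`
is the fraction of a ball of `ℝ^d` filled by a spherical sector of half-angle `θ`. -/
noncomputable def capI (d : ℕ) (x : ℝ) : ℝ := regIncBeta (1 - x ^ 2) (((d : ℝ) - 1) / 2) (1 / 2)

/-- `ρ(Σ)`: the positive square root of the spectral radius of `Σ`. -/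
noncomputable def rho {d : ℕ} (Sig : Matrix (Fin d) (Fin d) ℝ) : ℝ :=
  Real.sqrt (spectralRadius ℝ Sig).toReal

/-- `σ_i`: the positive square root of the `i`-th diagonal coefficient of `Σ`. -/
noncomputable def sigma {d : ℕ} (Sig : Matrix (Fin d) (Fin d) ℝ) (i : Fin d) : ℝ :=
  Real.sqrt (Sig i i)

/-- The signed Mahalanobis distances `r_i = -ȳ_i / σ_i` from the mean to the constraints. -/
noncomputable def mahal {d : ℕ} (ybar : EuclideanSpace ℝ (Fin d))
    (Sig : Matrix (Fin d) (Fin d) ℝ) (i : Fin d) : ℝ :=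
  -ybar i / sigma Sig i

/-- `r̃_i`, for `1 ≤ i ≤ d`, is the `i`-th smallest entry of `r` (with multiplicity), and `r̃_0 = 0`.
The value for `i > d` is irrelevant. -/
noncomputable def sortedMahal {d : ℕ} (ybar : EuclideanSpace ℝ (Fin d))
    (Sig : Matrix (Fin d) (Fin d) ℝ) (i : ℕ) : ℝ :=
  if h : 1 ≤ i ∧ i ≤ d then
    mahal ybar Sig (Tuple.sort (mahal ybar Sig) ⟨i - 1, by omega⟩)
  else 0

/-- The spectral radius failure risk estimation `β_{T,ρ} = Ψ_d(min(-ȳ) / ρ(Σ))`. -/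
noncomputable def betaRho {d : ℕ} (ybar : EuclideanSpace ℝ (Fin d))
    (Sig : Matrix (Fin d) (Fin d) ℝ) : ℝ :=
  Psi d ((⨅ i, -ybar i) / rho Sig)

/-- The first-order failure risk estimation `β_{T,1} = Ψ_d(min r)`. -/
noncomputable def betaOne {d : ℕ} (ybar : EuclideanSpace ℝ (Fin d))
    (Sig : Matrix (Fin d) (Fin d) ℝ) : ℝ :=
  Psi d (⨅ i, mahal ybar Sig i)

/-- The `d`-th order failure risk estimation
`β_{T,d} = 1 - ∑_{i=1}^d ΔΨ_d(r̃_{i-1}, r̃_i) max[0, 1 - (1/2) ∑_{j=1}^{i-1} 𝓘(r̃_j / r̃_i)]`. -/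
noncomputable def betaD {d : ℕ} (ybar : EuclideanSpace ℝ (Fin d))
    (Sig : Matrix (Fin d) (Fin d) ℝ) : ℝ :=
  1 - ∑ i ∈ Finset.Icc 1 d,
    deltaPsi d (sortedMahal ybar Sig (i - 1)) (sortedMahal ybar Sig i) *
      max 0 (1 - 1 / 2 * ∑ j ∈ Finset.Ico 1 i,
        capI d (sortedMahal ybar Sig j / sortedMahal ybar Sig i))

/-- The real risk `β_R = 1 - ℙ(y ⪯ 0)`. -/
noncomputable def betaReal {Ω : Type*} [MeasurableSpace Ω] (P : Measure Ω) {d : ℕ}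
    (y : Ω → EuclideanSpace ℝ (Fin d)) : ℝ :=
  1 - P.real {ω | ∀ i, y ω i ≤ 0}

/-- The conservatism `γ(β_T) = (β_T / β_R) √((1 - β_R²) / (1 - β_T²))` of an estimation `β_T ≤ 1` of
the real risk `β_R`. It is `[0, ∞]`-valued, with `γ(1) = ∞`, where the denominator vanishes. -/
noncomputable def conservatism (βR βT : ℝ) : ℝ≥0∞ :=
  if βT < 1 then ENNReal.ofReal (βT / βR * Real.sqrt ((1 - βR ^ 2) / (1 - βT ^ 2))) else ⊤

end ChanceConstraint

namespace ChanceConstraint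

lemma lintegral_mul_left_real {t : ℝ} (ht : 0 < t) {f : ℝ → ℝ≥0∞} (hf : Measurable f) :
    ∫⁻ s, f s = ENNReal.ofReal t * ∫⁻ v, f (t * v) := by
  conv_lhs => rw [← Real.smul_map_volume_mul_left ht.ne']
  rw [lintegral_smul_measure, lintegral_map hf (by fun_prop), abs_of_pos ht, smul_eq_mul]

/-- Density identity behind the independence of the sum and the ratio of two gamma variables. -/
lemma gammaPDF_mul_gammaPDF {a b r t v : ℝ} (ha : 0 < a) (hb : 0 < b) (hr : 0 < r) (ht : 0 < t)
    (h0 : v ≠ 0) (h1 : v ≠ 1) :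
    ENNReal.ofReal t * (gammaPDF a r (t - t * v) * gammaPDF b r (t * v)) =
      gammaPDF (a + b) r t * betaPDF b a v := by
  have htv : t - t * v = t * (1 - v) := by ring
  rcases lt_or_gt_of_ne h0 with hv | hv
  · rw [gammaPDF_of_neg (mul_neg_of_pos_of_neg ht hv), betaPDF_eq_zero_of_nonpos hv.le]; simp
  rcases lt_or_gt_of_ne h1 with hv1 | hv1
  swap
  · rw [htv, gammaPDF_of_neg (mul_neg_of_pos_of_neg ht (by linarith)),
      betaPDF_eq_zero_of_one_le hv1.le]
    simp
  have hv2 : 0 < 1 - v := by linarith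
  rw [htv, gammaPDF_of_nonneg (by positivity), gammaPDF_of_nonneg (by positivity),
    gammaPDF_of_nonneg ht.le, betaPDF_of_pos_lt_one hv hv1,
    ← ENNReal.ofReal_mul (by positivity), ← ENNReal.ofReal_mul ht.le,
    ← ENNReal.ofReal_mul (by positivity)]
  congr 1
  have e1 : Real.exp (-(r * (t * (1 - v)))) * Real.exp (-(r * (t * v))) = Real.exp (-(r * t)) := by
    rw [← Real.exp_add]; ring_nf
  have e2 : t * (t ^ (a - 1) * t ^ (b - 1)) = t ^ (a + b - 1) := by
    rw [← Real.rpow_add ht, mul_comm, ← Real.rpow_add_one ht.ne']; ring_nf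
  rw [Real.mul_rpow ht.le hv2.le, Real.mul_rpow ht.le hv.le, beta, Real.rpow_add hr, ← e1, ← e2,
    add_comm b a]
  have := Real.Gamma_pos_of_pos ha
  have := Real.Gamma_pos_of_pos hb
  have := Real.Gamma_pos_of_pos (add_pos ha hb)
  field_simp

/-- The sum and the ratio of two independent gamma variables are independent, and have a gamma and
a beta distribution. -/
theorem map_sum_ratio_gammaMeasure {a b r : ℝ} (ha : 0 < a) (hb : 0 < b) (hr : 0 < r) :
    ((gammaMeasure a r).prod (gammaMeasure b r)).map
      (fun p => (p.1 + p.2, p.2 / (p.1 + p.2))) =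
      (gammaMeasure (a + b) r).prod (betaMeasure b a) := by
  have := isProbabilityMeasure_gammaMeasure ha hr
  have := isProbabilityMeasure_gammaMeasure hb hr
  have := isProbabilityMeasure_gammaMeasure (add_pos ha hb) hr
  have := isProbabilityMeasureBeta hb ha
  have mg (c : ℝ) : Measurable (gammaPDF c r) := (measurable_gammaPDFReal c r).ennreal_ofReal
  have mb : Measurable (betaPDF b a) := (measurable_betaPDFReal b a).ennreal_ofReal
  refine Measure.ext_of_lintegral _ fun g hg => ?_
  rw [lintegral_map hg (by fun_prop), lintegral_prod_symm _ (by fun_prop),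
    lintegral_prod _ (by fun_prop)]
  simp only [gammaMeasure, betaMeasure]
  rw [lintegral_withDensity_eq_lintegral_mul _ (mg b) (by
      refine Measurable.lintegral_prod_left' (f := fun p : ℝ × ℝ => g (p.1 + p.2, p.2 / (p.1 + p.2))) ?_
      fun_prop),
    lintegral_withDensity_eq_lintegral_mul _ (mg (a + b)) (by
      refine Measurable.lintegral_prod_right' (f := g) hg)]
  have h1 (s : ℝ) : (gammaPDF b r * fun y => ∫⁻ x, g (x + y, y / (x + y))
      ∂(volume.withDensity (gammaPDF a r))) s =
      ∫⁻ t, gammaPDF a r (t - s) * gammaPDF b r s * g (t, s / t) := by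
    rw [Pi.mul_apply, lintegral_withDensity_eq_lintegral_mul _ (mg a) (by fun_prop),
      ← lintegral_const_mul _ (by fun_prop), ← lintegral_add_right_eq_self
        (fun t => gammaPDF a r (t - s) * gammaPDF b r s * g (t, s / t)) s]
    refine lintegral_congr fun x => ?_
    simp only [Pi.mul_apply, add_sub_cancel_right]
    ring
  simp_rw [h1]
  rw [lintegral_lintegral_swap (by fun_prop)]
  have hne : ∀ᵐ t : ℝ, t ≠ 0 := by simp [ae_iff]
  have hne1 : ∀ᵐ t : ℝ, t ≠ 1 := by simp [ae_iff]
  refine lintegral_congr_ae ?_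
  filter_upwards [hne] with t ht0
  rw [Pi.mul_apply]
  rcases lt_or_gt_of_ne ht0 with ht | ht
  · rw [gammaPDF_of_neg ht, zero_mul, lintegral_eq_zero_iff (by fun_prop)]
    refine Filter.Eventually.of_forall fun s => ?_
    rcases lt_or_ge s 0 with hs | hs
    · simp [gammaPDF_of_neg hs]
    · simp [gammaPDF_of_neg (show t - s < 0 by linarith)]
  · rw [lintegral_mul_left_real ht (by fun_prop),
      lintegral_withDensity_eq_lintegral_mul _ mb (by fun_prop),
      ← lintegral_const_mul _ (by fun_prop), ← lintegral_const_mul _ (by fun_prop)]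
    refine lintegral_congr_ae ?_
    filter_upwards [hne, hne1] with v hv0 hv1
    rw [← mul_assoc, gammaPDF_mul_gammaPDF ha hb hr ht hv0 hv1, mul_div_cancel_left₀ _ ht0,
      Pi.mul_apply, mul_assoc]

/-- The square of a standard normal variable has a gamma distribution. -/
theorem map_sq_gaussianReal :
    (gaussianReal 0 1).map (fun x => x ^ 2) = gammaMeasure (1 / 2) (1 / 2) := by
  have mg : Measurable (gammaPDF (1 / 2) (1 / 2)) :=
    (measurable_gammaPDFReal _ _).ennreal_ofReal
  refine Measure.ext_of_lintegral _ fun g hg => ?_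
  rw [lintegral_map hg (by fun_prop), gaussianReal_of_var_ne_zero _ one_ne_zero,
    lintegral_withDensity_eq_lintegral_mul _ (measurable_gaussianPDF _ _) (by fun_prop),
    gammaMeasure, lintegral_withDensity_eq_lintegral_mul _ mg hg]
  have key {x : ℝ} (hx : x ≠ 0) : ENNReal.ofReal |2 * x| * gammaPDF (1 / 2) (1 / 2) (x ^ 2) =
      2 * gaussianPDF 0 1 x := by
    rw [gammaPDF_of_nonneg (sq_nonneg x), gaussianPDF, gaussianPDFReal,
      ← ENNReal.ofReal_mul (abs_nonneg _),
      show (2 : ℝ≥0∞) = ENNReal.ofReal 2 by simp, ← ENNReal.ofReal_mul zero_le_two]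
    congr 1
    rw [Real.Gamma_one_half_eq, ← Real.sqrt_eq_rpow, ← sq_abs x, abs_mul, abs_two,
      ← Real.rpow_natCast, ← Real.rpow_mul (abs_nonneg x), NNReal.coe_one]
    have hx' : 0 < |x| := abs_pos.2 hx
    rw [show ((2 : ℕ) : ℝ) * (1 / 2 - 1) = -1 by norm_num, Real.rpow_neg_one,
      Real.rpow_natCast, sub_zero, sq_abs, Real.sqrt_div zero_le_one, Real.sqrt_one,
      Real.sqrt_mul (by positivity), Real.sqrt_mul zero_le_two, Real.sqrt_one,
      show -(1 / 2 * x ^ 2) = -x ^ 2 / (2 * 1) by ring]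
    field_simp
  have hd (s : Set ℝ) (x : ℝ) : HasDerivWithinAt (fun x : ℝ => x ^ 2) (2 * x) s x := by
    simpa using (hasDerivAt_pow 2 x).hasDerivWithinAt
  have hsplit (f : ℝ → ℝ≥0∞) : ∫⁻ x, f x = (∫⁻ x in Set.Iio 0, f x) + ∫⁻ x in Set.Ioi 0, f x := by
    rw [← lintegral_add_compl f measurableSet_Iio, Set.compl_Iio, setLIntegral_congr Ioi_ae_eq_Ici]
  have i1 : (fun x : ℝ => x ^ 2) '' Set.Ioi 0 = Set.Ioi 0 := by
    ext y; constructor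
    · rintro ⟨x, hx, rfl⟩; exact even_two.pow_pos (ne_of_gt (Set.mem_Ioi.1 hx))
    · exact fun hy => ⟨√y, Real.sqrt_pos.2 hy, Real.sq_sqrt (le_of_lt hy)⟩
  have i2 : (fun x : ℝ => x ^ 2) '' Set.Iio 0 = Set.Ioi 0 := by
    ext y; constructor
    · rintro ⟨x, hx, rfl⟩; exact even_two.pow_pos (ne_of_lt (Set.mem_Iio.1 hx))
    · exact fun hy => ⟨-√y, neg_lt_zero.2 (Real.sqrt_pos.2 hy), by
        simp [Real.sq_sqrt (le_of_lt hy)]⟩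
  have c1 := lintegral_image_eq_lintegral_abs_deriv_mul measurableSet_Ioi
    (fun x _ => hd (Set.Ioi 0) x)
    (fun x (hx : 0 < x) y (hy : 0 < y) h => (pow_left_inj₀ hx.le hy.le two_ne_zero).1 h)
    (gammaPDF (1 / 2) (1 / 2) * g)
  have c2 := lintegral_image_eq_lintegral_abs_deriv_mul measurableSet_Iio
    (fun x _ => hd (Set.Iio 0) x)
    (fun x (hx : x < 0) y (hy : y < 0) h => by
      have : (-x) ^ 2 = (-y) ^ 2 := by simpa using h
      linarith [(pow_left_inj₀ (neg_pos.2 hx).le (neg_pos.2 hy).le two_ne_zero).1 this])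
    (gammaPDF (1 / 2) (1 / 2) * g)
  rw [i1] at c1
  rw [i2] at c2
  have e (s : Set ℝ) (hs : MeasurableSet s) (h0 : ∀ x ∈ s, x ≠ 0) :
      ∫⁻ x in s, ENNReal.ofReal |2 * x| * (gammaPDF (1 / 2) (1 / 2) * g) (x ^ 2) =
        2 * ∫⁻ x in s, (gaussianPDF 0 1 * fun x => g (x ^ 2)) x := by
    rw [← lintegral_const_mul _ (by fun_prop)]
    refine setLIntegral_congr_fun hs fun x hx => ?_
    simp only [Pi.mul_apply]
    rw [← mul_assoc, key (h0 x hx), mul_assoc]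
  rw [e _ measurableSet_Ioi fun x hx => ne_of_gt hx] at c1
  rw [e _ measurableSet_Iio fun x hx => ne_of_lt hx] at c2
  have hneg : ∫⁻ y in Set.Iio 0, (gammaPDF (1 / 2) (1 / 2) * g) y = 0 := by
    rw [setLIntegral_eq_zero measurableSet_Iio]
    intro y hy
    simp [gammaPDF_of_neg hy]
  rw [hsplit, hsplit (_ * g), hneg, zero_add]
  refine (ENNReal.mul_right_inj two_ne_zero ENNReal.ofNat_ne_top).1 ?_
  rw [mul_add, ← c1, ← c2, two_mul]

instance isProbabilityMeasure_chiSquared (d : ℕ) : IsProbabilityMeasure (chiSquared d) :=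
  Measure.isProbabilityMeasure_map (Measurable.aemeasurable (by fun_prop))

/-- The joint law of the square of the first coordinate and of the sum of the squares of the other
ones. -/
lemma map_sq_sum_sq_succ (n : ℕ) :
    (Measure.pi fun _ : Fin (n + 1) => gaussianReal 0 1).map
      (fun z => (z 0 ^ 2, ∑ i : Fin n, z i.succ ^ 2)) =
      (gammaMeasure (1 / 2) (1 / 2)).prod (chiSquared n) := by
  have h := (measurePreserving_piFinSuccAbove (fun _ : Fin (n + 1) => gaussianReal 0 1) 0).map_eq
  rw [← map_sq_gaussianReal, chiSquared, Measure.map_prod_map _ _ (by fun_prop) (by fun_prop), ← h,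
    Measure.map_map (by fun_prop) (by fun_prop)]
  rfl

lemma chiSquared_succ (n : ℕ) : chiSquared (n + 1) = gammaMeasure (((n + 1 : ℕ) : ℝ) / 2) (1 / 2) := by
  induction n with
  | zero =>
    have h := congrArg (Measure.map Prod.fst) (map_sq_sum_sq_succ 0)
    rw [Measure.map_map (by fun_prop) (by fun_prop), Measure.map_fst_prod] at h
    simp only [measure_univ, one_smul] at h
    rw [chiSquared]
    simpa [Function.comp_def] using h
  | succ n ih =>
    have := isProbabilityMeasureBeta (α := ((n + 1 : ℕ) : ℝ) / 2) (β := 1 / 2)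
      (by positivity) (by norm_num)
    have h := congrArg (Measure.map fun p : ℝ × ℝ => p.1 + p.2) (map_sq_sum_sq_succ (n + 1))
    have h2 := congrArg (Measure.map Prod.fst) (map_sum_ratio_gammaMeasure (a := 1 / 2)
      (b := ((n + 1 : ℕ) : ℝ) / 2) (r := 1 / 2) (by norm_num) (by positivity) (by norm_num))
    rw [Measure.map_map (by fun_prop) (by fun_prop), Measure.map_fst_prod] at h2
    rw [Measure.map_map (by fun_prop) (by fun_prop), ih] at h
    simp only [measure_univ, one_smul] at h2
    have e : 1 / 2 + ((n + 1 : ℕ) : ℝ) / 2 = ((n + 1 + 1 : ℕ) : ℝ) / 2 := by push_cast; ring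
    rw [e] at h2
    rw [← h2, chiSquared]
    refine Eq.trans ?_ (h.trans rfl)
    simp [Function.comp_def, Fin.sum_univ_succ]

/-- The squared norm of a standard Gaussian vector and the squared sine of its angle to the first
axis are independent. -/
lemma map_norm_sq_sin_sq {n : ℕ} (hn : 0 < n) :
    (Measure.pi fun _ : Fin (n + 1) => gaussianReal 0 1).map
      (fun z => (∑ i, z i ^ 2, (∑ i : Fin n, z i.succ ^ 2) / ∑ i, z i ^ 2)) =
      (chiSquared (n + 1)).prod (betaMeasure ((n : ℝ) / 2) (1 / 2)) := by
  obtain ⟨n, rfl⟩ := Nat.exists_eq_add_of_lt hn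
  rw [zero_add]
  have h := map_sum_ratio_gammaMeasure (a := 1 / 2)
      (b := ((n + 1 : ℕ) : ℝ) / 2) (r := 1 / 2) (by norm_num) (by positivity) (by norm_num)
  have e : 1 / 2 + ((n + 1 : ℕ) : ℝ) / 2 = ((n + 1 + 1 : ℕ) : ℝ) / 2 := by push_cast; ring
  rw [e, ← chiSquared_succ, ← chiSquared_succ, ← map_sq_sum_sq_succ,
    Measure.map_map (by fun_prop) (by fun_prop)] at h
  rw [← h]
  congr 1
  ext z <;> simp [Fin.sum_univ_succ]

lemma betaMeasure_Iic {a b x : ℝ} (ha : 0 < a) (hb : 0 < b) (h0 : 0 ≤ x) (h1 : x ≤ 1) :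
    (betaMeasure a b).real (Set.Iic x) = regIncBeta x a b := by
  have hpos : ∀ y, 0 ≤ betaPDFReal a b y := fun y => by
    by_cases h : 0 < y ∧ y < 1
    · exact (betaPDFReal_pos h.1 h.2 ha hb).le
    · simp [betaPDFReal, h]
  rw [betaMeasure, measureReal_def, withDensity_apply _ measurableSet_Iic]
  simp only [betaPDF]
  rw [← integral_eq_lintegral_of_nonneg_ae (ae_of_all _ hpos) (by fun_prop), regIncBeta,
    intervalIntegral.integral_of_le h0, ← integral_const_mul, integral_Ioc_eq_integral_Ioo,
    integral_Iic_eq_integral_Iio,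
    setIntegral_eq_of_subset_of_forall_sdiff_eq_zero (s := Set.Ioo 0 x) measurableSet_Iio
      (fun y hy => hy.2)]
  · refine setIntegral_congr_fun measurableSet_Ioo fun y hy => ?_
    simp only [betaPDFReal]
    rw [if_pos ⟨hy.1, hy.2.trans_le h1⟩, mul_assoc]
  · rintro y ⟨hy, hy'⟩
    have : ¬ 0 < y := fun h => hy' ⟨h, hy⟩
    simp [betaPDFReal, this]

lemma measurableSet_lt_and_mem {α : Type*} [MeasurableSpace α] {f g h : α → ℝ} (hf : Measurable f)
    (hg : Measurable g) (hh : Measurable h) {A : Set ℝ} (hA : MeasurableSet A) :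
    MeasurableSet {z | f z < g z ∧ h z ∈ A} :=
  (measurableSet_lt hf hg).inter (hh hA)

lemma measureReal_pi_gaussian_cap_le {n : ℕ} (hn : 0 < n) {c : ℝ} (h0 : 0 ≤ c) (h1 : c ≤ 1)
    {A : Set ℝ} (hA : MeasurableSet A) :
    (Measure.pi fun _ : Fin (n + 1) => gaussianReal 0 1).real
      {z | c * √(∑ i, z i ^ 2) < z 0 ∧ ∑ i, z i ^ 2 ∈ A} ≤
      1 / 2 * capI (n + 1) c * (chiSquared (n + 1)).real A := by
  set μ := Measure.pi fun _ : Fin (n + 1) => gaussianReal 0 1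
  set S := {z : Fin (n + 1) → ℝ | c * √(∑ i, z i ^ 2) < z 0 ∧ ∑ i, z i ^ 2 ∈ A}
  set S' := {z : Fin (n + 1) → ℝ | c * √(∑ i, z i ^ 2) < -z 0 ∧ ∑ i, z i ^ 2 ∈ A}
  have hS : MeasurableSet S :=
    measurableSet_lt_and_mem (by fun_prop) (by fun_prop) (by fun_prop) hA
  have hS' : MeasurableSet S' :=
    measurableSet_lt_and_mem (by fun_prop) (by fun_prop) (by fun_prop) hA
  have hneg : MeasurePreserving (fun z : Fin (n + 1) → ℝ => fun i => -z i) μ μ :=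
    measurePreserving_pi _ _ fun _ => ⟨measurable_neg, by
      simpa using gaussianReal_map_neg (μ := 0) (v := 1)⟩
  have hSS' : μ.real S' = μ.real S := by
    rw [← hneg.measureReal_preimage hS.nullMeasurableSet]
    simp [S, S', Set.preimage]
  have hdisj : Disjoint S S' := by
    rw [Set.disjoint_left]
    rintro z ⟨hz, -⟩ ⟨hz', -⟩
    have : 0 ≤ c * √(∑ i, z i ^ 2) := by positivity
    linarith
  have hsub : S ∪ S' ⊆ (fun z => (∑ i, z i ^ 2, (∑ i : Fin n, z i.succ ^ 2) / ∑ i, z i ^ 2)) ⁻¹'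
      (A ×ˢ Set.Iic (1 - c ^ 2)) := by
    intro z hz
    have hA' : ∑ i, z i ^ 2 ∈ A := hz.elim (fun h => h.2) (fun h => h.2)
    refine ⟨hA', ?_⟩
    have hc : c * √(∑ i, z i ^ 2) < |z 0| :=
      hz.elim (fun h => h.1.trans_le (le_abs_self _)) (fun h => h.1.trans_le (neg_le_abs _))
    have hq : 0 ≤ ∑ i, z i ^ 2 := by positivity
    have hc2 : c ^ 2 * ∑ i, z i ^ 2 ≤ z 0 ^ 2 := by
      rw [← sq_abs (z 0), ← Real.sq_sqrt hq, ← mul_pow]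
      exact pow_le_pow_left₀ (by positivity) hc.le 2
    refine Set.mem_Iic.2 (div_le_of_le_mul₀ hq (by nlinarith) ?_)
    have := Fin.sum_univ_succ fun i => z i ^ 2
    linarith
  have hn' : (0 : ℝ) < (n : ℝ) / 2 := by positivity
  have := isProbabilityMeasureBeta hn' (show (0 : ℝ) < 1 / 2 by norm_num)
  have hprod : μ.real ((fun z => (∑ i, z i ^ 2, (∑ i : Fin n, z i.succ ^ 2) / ∑ i, z i ^ 2)) ⁻¹'
      (A ×ˢ Set.Iic (1 - c ^ 2))) = (chiSquared (n + 1)).real A * capI (n + 1) c := by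
    rw [← map_measureReal_apply (by fun_prop) (hA.prod measurableSet_Iic), map_norm_sq_sin_sq hn,
      measureReal_prod_prod, betaMeasure_Iic hn' (by norm_num) (by nlinarith) (by nlinarith), capI]
    simp
  have h := measureReal_mono hsub (measure_ne_top μ _)
  rw [hprod, measureReal_union hdisj hS', hSS'] at h
  linarith

lemma measureReal_stdGaussian_norm_sq {d : ℕ} {A : Set ℝ} (hA : MeasurableSet A) :
    (stdGaussian (EuclideanSpace ℝ (Fin d))).real {z | ‖z‖ ^ 2 ∈ A} = (chiSquared d).real A := by
  have hm : MeasurableSet {z : EuclideanSpace ℝ (Fin d) | ‖z‖ ^ 2 ∈ A} :=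
    hA.preimage (f := fun z : EuclideanSpace ℝ (Fin d) => ‖z‖ ^ 2) (by fun_prop)
  rw [← map_pi_eq_stdGaussian, map_measureReal_apply (by fun_prop) hm, chiSquared,
    map_measureReal_apply (by fun_prop) hA]
  simp [Set.preimage, EuclideanSpace.real_norm_sq_eq]

/-- Measure of the part of a spherical cone lying over a set of radii. -/
theorem measureReal_stdGaussian_cap_le {d : ℕ} (hd : 2 ≤ d) {u : EuclideanSpace ℝ (Fin d)}
    (hu : ‖u‖ = 1) {c : ℝ} (h0 : 0 ≤ c) (h1 : c ≤ 1) {A : Set ℝ} (hA : MeasurableSet A) :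
    (stdGaussian (EuclideanSpace ℝ (Fin d))).real {z | c * ‖z‖ < inner ℝ u z ∧ ‖z‖ ^ 2 ∈ A} ≤
      1 / 2 * capI d c * (chiSquared d).real A := by
  obtain ⟨n, rfl⟩ : ∃ n, d = n + 1 := ⟨d - 1, by omega⟩
  have horth : Orthonormal ℝ (Set.domRestrict {0} fun _ : Fin (n + 1) => u) :=
    ⟨fun _ => hu, fun i j hij => (hij (Subsingleton.elim i j)).elim⟩
  obtain ⟨b, hb⟩ := horth.exists_orthonormalBasis_extension_of_card_eq (by simp)
  have hb0 : b 0 = u := hb 0 rfl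
  have hmeas : MeasurableSet {z : EuclideanSpace ℝ (Fin (n + 1)) |
      c * ‖z‖ < inner ℝ u z ∧ ‖z‖ ^ 2 ∈ A} :=
    measurableSet_lt_and_mem (by fun_prop) (by fun_prop) (by fun_prop) hA
  refine le_trans (le_of_eq ?_) (measureReal_pi_gaussian_cap_le (by omega) h0 h1 hA)
  rw [stdGaussian_eq_map_pi_orthonormalBasis b, map_measureReal_apply (by fun_prop) hmeas]
  congr 1
  ext z
  have hnorm : ‖∑ i, z i • b i‖ ^ 2 = ∑ i, z i ^ 2 := by
    rw [← real_inner_self_eq_norm_sq, b.orthonormal.inner_sum]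
    simp [pow_two]
  have hinner : inner ℝ u (∑ i, z i • b i) = z 0 := by
    rw [← hb0, b.orthonormal.inner_right_fintype]
  simp only [Set.mem_preimage, Set.mem_ofPred_eq, hinner, hnorm]
  rw [← hnorm, Real.sqrt_sq (norm_nonneg _)]

lemma deltaPsi_eq_measureReal {d : ℕ} {a b : ℝ} (ha : 0 ≤ a) (hab : a ≤ b) :
    deltaPsi d a b = (chiSquared d).real (Set.Ioc (a ^ 2) (b ^ 2)) := by
  have h2 : a ^ 2 ≤ b ^ 2 := pow_le_pow_left₀ ha hab 2
  rw [deltaPsi, Psi, Psi, if_pos ha, if_pos (ha.trans hab), cdf_eq_real, cdf_eq_real,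
    ← Set.Iic_sdiff_Iic, measureReal_sdiff (Set.Iic_subset_Iic.2 h2) measurableSet_Iic]
  ring

/-- Lower bound of the Gaussian measure of an intersection of half-spaces, by a union bound on
the spherical caps that are cut off in each of the shells delimited by the distances `s j`. -/
theorem sum_deltaPsi_le_measureReal {d : ℕ} {v : ℕ → EuclideanSpace ℝ (Fin d)} {s : ℕ → ℝ}
    (hv : ∀ j ∈ Finset.Icc 1 d, ‖v j‖ = 1) (hs0 : s 0 = 0)
    (hs : ∀ i j, i ≤ j → j ≤ d → s i ≤ s j) :
    ∑ i ∈ Finset.Icc 1 d, deltaPsi d (s (i - 1)) (s i) *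
      max 0 (1 - 1 / 2 * ∑ j ∈ Finset.Ico 1 i, capI d (s j / s i)) ≤
    (stdGaussian (EuclideanSpace ℝ (Fin d))).real
      {z | ∀ j ∈ Finset.Icc 1 d, inner ℝ (v j) z ≤ s j} := by
  set μ := stdGaussian (EuclideanSpace ℝ (Fin d))
  set G := {z : EuclideanSpace ℝ (Fin d) | ∀ j ∈ Finset.Icc 1 d, inner ℝ (v j) z ≤ s j} with hGdef
  let A (i : ℕ) : Set ℝ := Set.Ioc (s (i - 1) ^ 2) (s i ^ 2)
  let shell (i : ℕ) : Set (EuclideanSpace ℝ (Fin d)) := {z | ‖z‖ ^ 2 ∈ A i}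
  have hnonneg {i : ℕ} (hi : i ≤ d) : 0 ≤ s i := hs0 ▸ hs 0 i (Nat.zero_le i) hi
  have hshell (i : ℕ) : MeasurableSet (shell i) :=
    measurableSet_Ioc.preimage (f := fun z : EuclideanSpace ℝ (Fin d) => ‖z‖ ^ 2) (by fun_prop)
  have hG : MeasurableSet G := by
    have : G = ⋂ j ∈ Finset.Icc 1 d, {z | inner ℝ (v j) z ≤ s j} := by ext; simp [hGdef]
    rw [this]
    exact Finset.measurableSet_biInter _ fun j _ => measurableSet_le (by fun_prop) (by fun_prop)
  have hdisj : Set.PairwiseDisjoint (Finset.Icc 1 d : Set ℕ) fun i => G ∩ shell i := by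
    have key {i j : ℕ} (hij : i < j) (hj : j ≤ d) {z} (hz : z ∈ shell i) (hz' : z ∈ shell j) :
        False := by
      have h1 : s i ≤ s (j - 1) := hs i (j - 1) (by omega) (by omega)
      have h2 : s i ^ 2 ≤ s (j - 1) ^ 2 := pow_le_pow_left₀ (hnonneg (by omega)) h1 2
      exact absurd (hz'.1.trans_le (hz.2.trans h2)) (lt_irrefl _)
    intro i hi j hj hij
    rw [Finset.coe_Icc, Set.mem_Icc] at hi hj
    refine Set.disjoint_left.2 fun z hz hz' => ?_
    rcases lt_or_gt_of_ne hij with h | h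
    · exact key h hj.2 hz.2 hz'.2
    · exact key h hi.2 hz'.2 hz.2
  calc _ ≤ ∑ i ∈ Finset.Icc 1 d, μ.real (G ∩ shell i) := ?_
    _ = μ.real (⋃ i ∈ Finset.Icc 1 d, G ∩ shell i) :=
      (measureReal_biUnion_finset hdisj fun i _ => hG.inter (hshell i)).symm
    _ ≤ μ.real G := measureReal_mono (Set.iUnion₂_subset fun i _ => Set.inter_subset_left)
  refine Finset.sum_le_sum fun i hi => ?_
  rw [Finset.mem_Icc] at hi
  rw [deltaPsi_eq_measureReal (hnonneg (by omega)) (hs _ _ (by omega) hi.2),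
    mul_max_of_nonneg _ _ measureReal_nonneg, mul_zero]
  refine max_le measureReal_nonneg ?_
  let cap (j : ℕ) : Set (EuclideanSpace ℝ (Fin d)) :=
    {z | s j / s i * ‖z‖ < inner ℝ (v j) z ∧ ‖z‖ ^ 2 ∈ A i}
  have hsub : shell i ⊆ (G ∩ shell i) ∪ ⋃ j ∈ Finset.Ico 1 i, cap j := by
    intro z hz
    by_cases hzG : z ∈ G
    · exact Or.inl ⟨hzG, hz⟩
    obtain ⟨j, hj, hjz⟩ : ∃ j ∈ Finset.Icc 1 d, s j < inner ℝ (v j) z := by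
      by_contra! h
      exact hzG h
    have hzi : ‖z‖ ≤ s i := (pow_le_pow_iff_left₀ (norm_nonneg z) (hnonneg hi.2) two_ne_zero).1 hz.2
    have hz0 : 0 < ‖z‖ := by
      refine (norm_nonneg z).lt_of_ne fun h => ?_
      have := hz.1
      rw [← h] at this
      nlinarith [sq_nonneg (s (i - 1))]
    have hinner : inner ℝ (v j) z ≤ ‖z‖ := by
      simpa [hv j hj] using real_inner_le_norm (v j) z
    rw [Finset.mem_Icc] at hj
    have hji : j < i := by
      by_contra! h
      linarith [hs i j h hj.2]
    refine Or.inr (Set.mem_iUnion₂.2 ⟨j, Finset.mem_Ico.2 ⟨hj.1, hji⟩, lt_of_le_of_lt ?_ hjz, hz⟩)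
    rw [div_mul_eq_mul_div, div_le_iff₀ (hz0.trans_le hzi)]
    exact mul_le_mul_of_nonneg_left hzi (hnonneg hj.2)
  have hcap (j : ℕ) (hj : j ∈ Finset.Ico 1 i) :
      μ.real (cap j) ≤ 1 / 2 * capI d (s j / s i) * (chiSquared d).real (A i) := by
    rw [Finset.mem_Ico] at hj
    exact measureReal_stdGaussian_cap_le (by omega) (hv j (Finset.mem_Icc.2 ⟨hj.1, by omega⟩))
      (div_nonneg (hnonneg (by omega)) (hnonneg hi.2))
      (div_le_one_of_le₀ (hs _ _ hj.2.le hi.2) (hnonneg hi.2)) measurableSet_Ioc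
  have h1 : μ.real (shell i) ≤ μ.real (G ∩ shell i) + ∑ j ∈ Finset.Ico 1 i, μ.real (cap j) :=
    (measureReal_mono hsub).trans ((measureReal_union_le _ _).trans
      (add_le_add_right (measureReal_biUnion_finset_le _ _) _))
  have h2 := Finset.sum_le_sum hcap
  rw [← Finset.sum_mul, ← Finset.mul_sum] at h2
  rw [show μ.real (shell i) = _ from measureReal_stdGaussian_norm_sq measurableSet_Ioc] at h1
  change (chiSquared d).real (A i) * _ ≤ _
  linarith

instance isOpenPosMeasure_stdGaussian (d : ℕ) :
    (stdGaussian (EuclideanSpace ℝ (Fin d))).IsOpenPosMeasure := by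
  have : (gaussianReal 0 1).IsOpenPosMeasure :=
    (gaussianReal_absolutelyContinuous' 0 one_ne_zero).isOpenPosMeasure
  rw [← map_pi_eq_stdGaussian]
  exact (PiLp.continuous_toLp 2 _).isOpenPosMeasure_map (WithLp.toLp_surjective 2)

open scoped MatrixOrder

section Covariance

variable {d : ℕ} {Sig : Matrix (Fin d) (Fin d) ℝ}

lemma surjective_add_toEuclideanCLM_sqrt (hSig : Sig.PosDef) (m : EuclideanSpace ℝ (Fin d)) :
    Function.Surjective fun x => m + Matrix.toEuclideanCLM (𝕜 := ℝ) (CFC.sqrt Sig) x := by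
  intro x
  refine ⟨Matrix.toEuclideanCLM (𝕜 := ℝ) (CFC.sqrt Sig * Sig⁻¹) (x - m), ?_⟩
  have h : CFC.sqrt Sig * (CFC.sqrt Sig * Sig⁻¹) = 1 := by
    rw [← mul_assoc, CFC.sqrt_mul_sqrt_self Sig hSig.posSemidef.nonneg,
      Matrix.mul_nonsing_inv _ hSig.det_pos.ne'.isUnit]
  change m + (Matrix.toEuclideanCLM (𝕜 := ℝ) (CFC.sqrt Sig) *
    Matrix.toEuclideanCLM (𝕜 := ℝ) (CFC.sqrt Sig * Sig⁻¹)) (x - m) = x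
  rw [← map_mul, h]
  simp

lemma isOpenPosMeasure_multivariateGaussian (hSig : Sig.PosDef) (m : EuclideanSpace ℝ (Fin d)) :
    (multivariateGaussian m Sig).IsOpenPosMeasure :=
  Continuous.isOpenPosMeasure_map (by fun_prop) (surjective_add_toEuclideanCLM_sqrt hSig m)

lemma sigma_pos (hSig : Sig.PosDef) (i : Fin d) : 0 < sigma Sig i :=
  Real.sqrt_pos.2 (hSig.diag_pos)

/-- The inward unit normal of the `i`-th half-space in whitened coordinates. -/
noncomputable def whitenedNormal (Sig : Matrix (Fin d) (Fin d) ℝ) (i : Fin d) :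
    EuclideanSpace ℝ (Fin d) :=
  (sigma Sig i)⁻¹ • WithLp.toLp 2 (CFC.sqrt Sig i)

lemma inner_whitenedNormal (i : Fin d) (z : EuclideanSpace ℝ (Fin d)) :
    inner ℝ (whitenedNormal Sig i) z =
      Matrix.toEuclideanCLM (𝕜 := ℝ) (CFC.sqrt Sig) z i / sigma Sig i := by
  rw [whitenedNormal, real_inner_smul_left, Matrix.ofLp_toEuclideanCLM, div_eq_inv_mul]
  simp [PiLp.inner_apply, Matrix.mulVec, dotProduct, mul_comm]

lemma norm_whitenedNormal (hSig : Sig.PosDef) (i : Fin d) : ‖whitenedNormal Sig i‖ = 1 := by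
  have hrow : ‖WithLp.toLp 2 (CFC.sqrt Sig i)‖ = sigma Sig i := by
    rw [sigma, EuclideanSpace.norm_eq]
    congr 1
    conv_rhs => rw [← CFC.sqrt_mul_sqrt_self Sig hSig.posSemidef.nonneg, Matrix.mul_apply]
    refine Finset.sum_congr rfl fun j _ => ?_
    have h : (CFC.sqrt Sig).IsHermitian := (CFC.sqrt_nonneg Sig).isSelfAdjoint
    have hij : CFC.sqrt Sig j i = CFC.sqrt Sig i j := by simpa using h.apply i j
    rw [hij, Real.norm_eq_abs, sq_abs, pow_two]
  rw [whitenedNormal, norm_smul, hrow, norm_inv, Real.norm_of_nonneg (sigma_pos hSig i).le,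
    inv_mul_cancel₀ (sigma_pos hSig i).ne']

open scoped Matrix.Norms.L2Operator in
lemma sigma_le_rho (hSig : Sig.PosDef) (i : Fin d) : sigma Sig i ≤ rho Sig := by
  refine Real.sqrt_le_sqrt ?_
  have : Nonempty (Fin d) := ⟨i⟩
  have hfin : spectralRadius ℝ Sig ≠ ⊤ :=
    ne_top_of_le_ne_top ENNReal.coe_ne_top (spectrum.spectralRadius_le_nnnorm Sig)
  have hle : Sig ≤ algebraMap ℝ _ (spectralRadius ℝ Sig).toReal := by
    refine le_algebraMap_of_spectrum_le fun x hx => ?_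
    have h : (‖x‖₊ : ℝ≥0∞) ≤ spectralRadius ℝ Sig :=
      le_iSup₂ (f := fun k (_ : k ∈ spectrum ℝ Sig) => (‖k‖₊ : ℝ≥0∞)) x hx
    have := ENNReal.toReal_mono hfin h
    exact (le_abs_self x).trans (by simpa using this)
  have := (Matrix.le_iff.1 hle).diag_nonneg (i := i)
  simpa [Matrix.algebraMap_matrix_apply] using this

end Covariance

lemma Psi_le_one (d : ℕ) (r : ℝ) : Psi d r ≤ 1 := by
  rw [Psi]
  split_ifs
  · linarith [cdf_nonneg (chiSquared d) (r ^ 2)]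
  · rfl

lemma Psi_antitone (d : ℕ) : Antitone (Psi d) := by
  intro a b hab
  by_cases ha : 0 ≤ a
  · rw [Psi, Psi, if_pos ha, if_pos (ha.trans hab)]
    linarith [monotone_cdf (chiSquared d) (pow_le_pow_left₀ ha hab 2)]
  · rw [Psi.eq_1 d a, if_neg ha]
    exact Psi_le_one d b

lemma Psi_zero {d : ℕ} (hd : 0 < d) : Psi d 0 = 1 := by
  obtain ⟨n, rfl⟩ := Nat.exists_eq_add_of_lt hd
  rw [zero_add, Psi, if_pos le_rfl, zero_pow two_ne_zero, chiSquared_succ,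
    cdf_gammaMeasure_eq_lintegral (by positivity) (by norm_num),
    setLIntegral_congr Iio_ae_eq_Iic.symm, lintegral_gammaPDF_of_nonpos le_rfl]
  simp

lemma measurableSet_forall_eval_le {d : ℕ} :
    MeasurableSet {x : EuclideanSpace ℝ (Fin d) | ∀ i, x i ≤ 0} := by
  simp only [Set.ofPred_forall]
  exact MeasurableSet.iInter fun i => measurableSet_le (by fun_prop) (by fun_prop)

lemma measureReal_forall_eval_le_mem_Ioo {d : ℕ} (hd : 0 < d) {Sig : Matrix (Fin d) (Fin d) ℝ}
    (hSig : Sig.PosDef) (m : EuclideanSpace ℝ (Fin d)) :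
    (multivariateGaussian m Sig).real {x | ∀ i, x i ≤ 0} ∈ Set.Ioo 0 1 := by
  have := isOpenPosMeasure_multivariateGaussian hSig m
  have hpos {U : Set (EuclideanSpace ℝ (Fin d))} (hU : IsOpen U) (hne : U.Nonempty) :
      0 < (multivariateGaussian m Sig).real U :=
    ENNReal.toReal_pos (hU.measure_pos _ hne).ne' (measure_ne_top _ _)
  have hn : 0 < (multivariateGaussian m Sig).real {x | ∀ i, x i < 0} := by
    refine hpos ?_ ⟨WithLp.toLp 2 fun _ => -1, fun i => by simp⟩
    simp only [Set.ofPred_forall]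
    exact isOpen_iInter_of_finite fun i => isOpen_lt (by fun_prop) (by fun_prop)
  have hp : 0 < (multivariateGaussian m Sig).real {x | 0 < x ⟨0, hd⟩} :=
    hpos (isOpen_lt (by fun_prop) (by fun_prop)) ⟨WithLp.toLp 2 fun _ => 1, by simp⟩
  constructor
  · exact hn.trans_le (measureReal_mono fun x hx i => (hx i).le)
  · have h := measureReal_mono (μ := multivariateGaussian m Sig)
      (show {x : EuclideanSpace ℝ (Fin d) | 0 < x ⟨0, hd⟩} ⊆ {x | ∀ i, x i ≤ 0}ᶜ from
        fun x hx hx' => absurd (hx' ⟨0, hd⟩) (not_le.2 hx))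
    rw [probReal_compl_eq_one_sub measurableSet_forall_eval_le] at h
    linarith

section Estimations

variable {d : ℕ} {ybar : EuclideanSpace ℝ (Fin d)} {Sig : Matrix (Fin d) (Fin d) ℝ}

lemma mahal_nonneg (hybar : ∀ i, ybar i ≤ 0) (i : Fin d) : 0 ≤ mahal ybar Sig i :=
  div_nonneg (neg_nonneg.2 (hybar i)) (Real.sqrt_nonneg _)

lemma sortedMahal_zero : sortedMahal ybar Sig 0 = 0 := by simp [sortedMahal]

lemma sortedMahal_of_mem {j : ℕ} (h : 1 ≤ j ∧ j ≤ d) : sortedMahal ybar Sig j =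
    mahal ybar Sig (Tuple.sort (mahal ybar Sig) ⟨j - 1, by omega⟩) := dif_pos h

lemma sortedMahal_mono (hybar : ∀ i, ybar i ≤ 0) {i j : ℕ} (hij : i ≤ j) (hj : j ≤ d) :
    sortedMahal ybar Sig i ≤ sortedMahal ybar Sig j := by
  rcases Nat.eq_zero_or_pos i with rfl | hi
  · rw [sortedMahal_zero, sortedMahal]
    split_ifs
    exacts [mahal_nonneg hybar _, le_rfl]
  · rw [sortedMahal_of_mem ⟨hi, hij.trans hj⟩, sortedMahal_of_mem ⟨le_trans hi hij, hj⟩]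
    exact Tuple.monotone_sort (mahal ybar Sig) (Fin.mk_le_mk.2 (by omega))

lemma sortedMahal_one (hd : 0 < d) : sortedMahal ybar Sig 1 = ⨅ i, mahal ybar Sig i := by
  have : Nonempty (Fin d) := ⟨⟨0, hd⟩⟩
  rw [sortedMahal_of_mem ⟨le_rfl, hd⟩]
  refine le_antisymm (le_ciInf fun i => ?_) (ciInf_le (Set.finite_range _).bddBelow _)
  have := Tuple.monotone_sort (mahal ybar Sig)
    (show (⟨0, hd⟩ : Fin d) ≤ (Tuple.sort (mahal ybar Sig)).symm i from Nat.zero_le _)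
  simpa using this

lemma betaD_le_betaOne (hd : 0 < d) (hybar : ∀ i, ybar i ≤ 0) :
    betaD ybar Sig ≤ betaOne ybar Sig := by
  have hnonneg : ∀ i ∈ Finset.Icc 1 d,
      0 ≤ deltaPsi d (sortedMahal ybar Sig (i - 1)) (sortedMahal ybar Sig i) *
        max 0 (1 - 1 / 2 * ∑ j ∈ Finset.Ico 1 i,
          capI d (sortedMahal ybar Sig j / sortedMahal ybar Sig i)) := fun i hi =>
    mul_nonneg (sub_nonneg.2 (Psi_antitone d
      (sortedMahal_mono hybar (Nat.sub_le i 1) (Finset.mem_Icc.1 hi).2))) (le_max_left _ _)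
  have h := Finset.single_le_sum hnonneg (Finset.mem_Icc.2 ⟨le_rfl, hd⟩)
  simp only [Nat.sub_self, sortedMahal_zero, deltaPsi, Psi_zero hd, Finset.Ico_self,
    Finset.sum_empty, mul_zero, sub_zero, max_eq_right zero_le_one, mul_one,
    sortedMahal_one hd] at h
  rw [betaD, betaOne]
  simp only [deltaPsi]
  linarith

lemma betaOne_le_betaRho (hd : 0 < d) (hSig : Sig.PosDef) (hybar : ∀ i, ybar i ≤ 0) :
    betaOne ybar Sig ≤ betaRho ybar Sig := by
  have : Nonempty (Fin d) := ⟨⟨0, hd⟩⟩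
  refine Psi_antitone d (le_ciInf fun i => ?_)
  rw [mahal]
  exact div_le_div₀ (neg_nonneg.2 (hybar i)) (ciInf_le (Set.finite_range _).bddBelow i)
    (sigma_pos hSig i) (sigma_le_rho hSig i)

lemma one_sub_betaD_le (hSig : Sig.PosDef) (hybar : ∀ i, ybar i ≤ 0) :
    1 - betaD ybar Sig ≤ (multivariateGaussian ybar Sig).real {x | ∀ i, x i ≤ 0} := by
  let v (j : ℕ) : EuclideanSpace ℝ (Fin d) := if h : 1 ≤ j ∧ j ≤ d then
    whitenedNormal Sig (Tuple.sort (mahal ybar Sig) ⟨j - 1, by omega⟩) else 0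
  have hv {j : ℕ} (h : 1 ≤ j ∧ j ≤ d) :
      v j = whitenedNormal Sig (Tuple.sort (mahal ybar Sig) ⟨j - 1, by omega⟩) := dif_pos h
  have hmeas : MeasurableSet {x : EuclideanSpace ℝ (Fin d) | ∀ i, x i ≤ 0} :=
    measurableSet_forall_eval_le
  rw [betaD, sub_sub_cancel, multivariateGaussian, map_measureReal_apply (by fun_prop) hmeas]
  refine (sum_deltaPsi_le_measureReal (v := v) (fun j hj => ?_) sortedMahal_zero
    (fun i j hij hj => sortedMahal_mono hybar hij hj)).trans_eq ?_
  · rw [hv (Finset.mem_Icc.1 hj), norm_whitenedNormal hSig]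
  congr 1
  ext z
  have hiff (i : Fin d) : inner ℝ (whitenedNormal Sig i) z ≤ mahal ybar Sig i ↔
      (ybar + Matrix.toEuclideanCLM (𝕜 := ℝ) (CFC.sqrt Sig) z) i ≤ 0 := by
    rw [inner_whitenedNormal, mahal, div_le_div_iff_of_pos_right (sigma_pos hSig i), PiLp.add_apply]
    constructor <;> intro h <;> linarith
  change (∀ j ∈ Finset.Icc 1 d, _) ↔ ∀ i, _
  constructor
  · intro h i
    set k := (Tuple.sort (mahal ybar Sig)).symm i with hk
    have hmem : 1 ≤ (k : ℕ) + 1 ∧ (k : ℕ) + 1 ≤ d := ⟨by omega, k.2⟩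
    have := h (k + 1) (Finset.mem_Icc.2 hmem)
    rw [hv hmem, sortedMahal_of_mem hmem] at this
    rw [← hiff]
    simpa [hk] using this
  · intro h j hj
    rw [Finset.mem_Icc] at hj
    rw [hv hj, sortedMahal_of_mem hj, hiff]
    exact h _

end Estimations

/-- The conservatism is strictly increasing. -/
theorem strictMonoOn_conservatism {βR : ℝ} (h0 : 0 < βR) (h1 : βR < 1) :
    StrictMonoOn (conservatism βR) (Set.Icc 0 1) := by
  rintro a ⟨ha0, -⟩ b ⟨-, hb1⟩ hab
  have ha1 : a < 1 := hab.trans_le hb1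
  rw [conservatism, if_pos ha1, conservatism]
  split_ifs with hb
  · have hR : 0 < 1 - βR ^ 2 := by nlinarith
    have hb2 : 0 < 1 - b ^ 2 := by nlinarith
    have hb0 : 0 < b := ha0.trans_lt hab
    refine (ENNReal.ofReal_lt_ofReal_iff (by positivity)).2 ?_
    refine mul_lt_mul (div_lt_div_of_pos_right hab h0) (Real.sqrt_le_sqrt ?_)
      (Real.sqrt_pos.2 (div_pos hR (by nlinarith))) (by positivity)
    exact div_le_div_of_nonneg_left hR.le hb2 (by nlinarith)
  · exact ENNReal.ofReal_lt_top

lemma conservatism_self {βR : ℝ} (h0 : 0 < βR) (h1 : βR < 1) : conservatism βR βR = 1 := by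
  have hR : 1 - βR ^ 2 ≠ 0 := by nlinarith
  rw [conservatism, if_pos h1, div_self h0.ne', div_self hR]
  simp

end ChanceConstraint

theorem mainTheorem4 {Ω : Type*} [MeasurableSpace Ω] (P : MeasureTheory.Measure Ω)
    [MeasureTheory.IsProbabilityMeasure P] {d : ℕ} (hd : 0 < d)
    (ybar : EuclideanSpace ℝ (Fin d)) (Sig : Matrix (Fin d) (Fin d) ℝ) (hSig : Sig.PosDef)
    (y : Ω → EuclideanSpace ℝ (Fin d))
    (hy : ProbabilityTheory.HasLaw y (ProbabilityTheory.multivariateGaussian ybar Sig) P)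
    (hybar : ∀ i, ybar i ≤ 0) :
    (0 < ChanceConstraint.betaReal P y ∧ ChanceConstraint.betaReal P y < 1) ∧
    (ChanceConstraint.betaReal P y ≤ ChanceConstraint.betaD ybar Sig ∧
      ChanceConstraint.betaD ybar Sig ≤ ChanceConstraint.betaOne ybar Sig ∧
      ChanceConstraint.betaOne ybar Sig ≤ ChanceConstraint.betaRho ybar Sig ∧
      ChanceConstraint.betaRho ybar Sig ≤ 1) ∧
    StrictMonoOn (ChanceConstraint.conservatism (ChanceConstraint.betaReal P y))
      (Set.Icc 0 1) ∧
    (1 ≤ ChanceConstraint.conservatism (ChanceConstraint.betaReal P y)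
        (ChanceConstraint.betaD ybar Sig) ∧
      ChanceConstraint.conservatism (ChanceConstraint.betaReal P y)
          (ChanceConstraint.betaD ybar Sig) ≤
        ChanceConstraint.conservatism (ChanceConstraint.betaReal P y)
          (ChanceConstraint.betaOne ybar Sig) ∧
      ChanceConstraint.conservatism (ChanceConstraint.betaReal P y)
          (ChanceConstraint.betaOne ybar Sig) ≤
        ChanceConstraint.conservatism (ChanceConstraint.betaReal P y)
          (ChanceConstraint.betaRho ybar Sig)) := by
  open ChanceConstraint in
  have hmeas : MeasurableSet {x : EuclideanSpace ℝ (Fin d) | ∀ i, x i ≤ 0} :=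
    measurableSet_forall_eval_le
  have hβ : betaReal P y = 1 - (multivariateGaussian ybar Sig).real {x | ∀ i, x i ≤ 0} := by
    rw [betaReal, hy.measureReal_eq hmeas]
  obtain ⟨h0, h1⟩ := measureReal_forall_eval_le_mem_Ioo hd hSig ybar
  have hR0 : 0 < betaReal P y := by linarith
  have hR1 : betaReal P y < 1 := by linarith
  have hRD : betaReal P y ≤ betaD ybar Sig := by linarith [one_sub_betaD_le hSig hybar]
  have hD1 := betaD_le_betaOne (Sig := Sig) hd hybar
  have h1ρ := betaOne_le_betaRho hd hSig hybar
  have hρ : betaRho ybar Sig ≤ 1 := Psi_le_one _ _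
  have hmono := strictMonoOn_conservatism hR0 hR1
  have mR : betaReal P y ∈ Set.Icc (0 : ℝ) 1 := ⟨hR0.le, hR1.le⟩
  have mD : betaD ybar Sig ∈ Set.Icc (0 : ℝ) 1 := ⟨hR0.le.trans hRD, hD1.trans (h1ρ.trans hρ)⟩
  have m1 : betaOne ybar Sig ∈ Set.Icc (0 : ℝ) 1 := ⟨mD.1.trans hD1, h1ρ.trans hρ⟩
  have mρ : betaRho ybar Sig ∈ Set.Icc (0 : ℝ) 1 := ⟨m1.1.trans h1ρ, hρ⟩
  refine ⟨⟨hR0, hR1⟩, ⟨hRD, hD1, h1ρ, hρ⟩, hmono, ?_, (hmono.le_iff_le mD m1).2 hD1,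
    (hmono.le_iff_le m1 mρ).2 h1ρ⟩
  rw [← conservatism_self hR0 hR1]
  exact (hmono.le_iff_le mR mD).2 hRD
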